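/- Let $\mathbb F$ be an algebraically closed field of characteristic zero and let $q\in\mathbb F$ satisfy $q\neq 0$ and $q^2\neq 1$. All algebras are associative and unital over $\mathbb F$. For $\alpha,\beta,\gamma\in\mathbb F$ let $\mathbb A(\alpha,\beta,\gamma)$ be the algebra with generators $A,B,C$ and relations \begin{align*} BA^2&=\alpha ABA+\beta A^2B+\gamma A, & B^2A&=\alpha BAB+\beta AB^2+\gamma B,\\ CB^2&=\alpha BCB+\beta B^2C+\gamma B, & C^2B&=\alpha CBC+\beta BC^2+\gamma C,\\ AC^2&=\alpha CAC+\beta C^2A+\gamma C, & A^2C&=\alpha ACA+\beta CA^2+\gamma A. \end{align*} Let $\mathcal C$ be the $3\times 3$ matrix with $\mathcal C_{i,i}=2$ and $\mathcal C_{i,j}=-1$ for $i\neq j$, and let $U_q(A_2^{(1)})$ be the algebra with generators $E_i,F_i,K_i,K_i^{-1}$ $(1\le i\le 3)$ and, for $1\le i,j\le 3$, relations \begin{align*} &K_iK_i^{-1}=K_i^{-1}K_i=1,\qquad K_iK_j=K_jK_i,\\ &K_iE_jK_i^{-1}=q^{\mathcal C_{i,j}}E_j,\qquad K_iF_jK_i^{-1}=q^{-\mathcal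 C_{i,j}}F_j,\\ &E_iF_j-F_jE_i=\delta_{i,j}\frac{K_i-K_i^{-1}}{q-q^{-1}},\\ &E_i^2E_j-(q+q^{-1})E_iE_jE_i+E_jE_i^2=0\quad(i\neq j),\\ &F_i^2F_j-(q+q^{-1})F_iF_jF_i+F_jF_i^2=0\quad(i\neq j). \end{align*} Let $U_q^+$ denote the subalgebra of $U_q(A_2^{(1)})$ generated by $E_1,E_2,E_3$. Then there exists an algebra homomorphism $\mathbb A(q+q^{-1},-1,0)\to U_q(A_2^{(1)})$ that sends $A\mapsto E_1$, $B\mapsto E_2$, $C\mapsto E_3$. This homomorphism is injective, and its image is $U_q^+$. Moreover, $U_q^+$ is presented by the generators $E_1,E_2,E_3$ and the quantum Serre relations $E_i^2E_j-(q+q^{-1})E_iE_jE_i+E_jE_i^2=0$ $(1\le i,j\le 3,\ i\neq j)$; that is, the algebra with generators $x_1,x_2,x_3$ and the relations $x_i^2x_j-(q+q^{-1})x_ix_jx_i+x_jx_i^2=0$ $(i\ne j)$ is isomorphic to $U_q^+$ via $x_i\mapsto E_i$. -/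

import Mathlib

noncomputable section

namespace Z3DownUp

/-- The three standard generators of the `ℤ₃`-symmetric down-up algebra. -/
inductive Gen
  | A
  | B
  | C

section DownUp

variable {𝕜 : Type*} [Field 𝕜]

/-- Generator letters in the free algebra. -/
abbrev free (x : Gen) : FreeAlgebra 𝕜 Gen := FreeAlgebra.ι 𝕜 x

/-- The six `ℤ₃`-symmetric down-up relations with parameters `α, β, γ`. -/
inductive Rel (α β γ : 𝕜) : FreeAlgebra 𝕜 Gen → FreeAlgebra 𝕜 Gen → Prop
  | BAA : Rel α β γ (free .B * free .A ^ 2)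
      (α • (free .A * free .B * free .A) + β • (free .A ^ 2 * free .B) + γ • free .A)
  | BBA : Rel α β γ (free .B ^ 2 * free .A)
      (α • (free .B * free .A * free .B) + β • (free .A * free .B ^ 2) + γ • free .B)
  | CBB : Rel α β γ (free .C * free .B ^ 2)
      (α • (free .B * free .C * free .B) + β • (free .B ^ 2 * free .C) + γ • free .B)
  | CCB : Rel α β γ (free .C ^ 2 * free .B)
      (α • (free .C * free .B * free .C) + β • (free .B * free .C ^ 2) + γ • free .C)
  | ACC : Rel α β γ (free .A * free .C ^ 2)
      (α • (free .C * free .A * free .C) + β • (free .C ^ 2 * free .A) + γ • free .C)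
  | AAC : Rel α β γ (free .A ^ 2 * free .C)
      (α • (free .A * free .C * free .A) + β • (free .C * free .A ^ 2) + γ • free .A)

/-- The `ℤ₃`-symmetric down-up algebra `𝔸(α, β, γ)`. -/
abbrev Alg (α β γ : 𝕜) : Type _ := RingQuot (Rel α β γ)

/-- The image of a generator in `𝔸(α, β, γ)`. -/
def gen (α β γ : 𝕜) (x : Gen) : Alg α β γ :=
  RingQuot.mkAlgHom 𝕜 (Rel α β γ) (free x)

end DownUp

end Z3DownUp

namespace UqAffine

/-- The Cartan matrix of type `A₂⁽¹⁾`; the indices `0, 1, 2` stand for `1, 2, 3`. -/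
def cartan : Matrix (Fin 3) (Fin 3) ℤ :=
  !![2, -1, -1; -1, 2, -1; -1, -1, 2]

/-- The generators `E_i, F_i, K_i, K_i⁻¹`. -/
inductive Gen
  | E (i : Fin 3)
  | F (i : Fin 3)
  | K (i : Fin 3)
  | Kinv (i : Fin 3)

section Uq

variable {𝕜 : Type*} [Field 𝕜]

/-- Generator letters in the free algebra. -/
abbrev free (x : Gen) : FreeAlgebra 𝕜 Gen := FreeAlgebra.ι 𝕜 x

/-- The defining relations of `U_q(A₂⁽¹⁾)`. -/
inductive Rel (q : 𝕜) : FreeAlgebra 𝕜 Gen → FreeAlgebra 𝕜 Gen → Prop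
  | K_mul_Kinv (i : Fin 3) : Rel q (free (.K i) * free (.Kinv i)) 1
  | Kinv_mul_K (i : Fin 3) : Rel q (free (.Kinv i) * free (.K i)) 1
  | K_comm (i j : Fin 3) : Rel q (free (.K i) * free (.K j)) (free (.K j) * free (.K i))
  | K_E (i j : Fin 3) : Rel q (free (.K i) * free (.E j) * free (.Kinv i))
      (q ^ cartan i j • free (.E j))
  | K_F (i j : Fin 3) : Rel q (free (.K i) * free (.F j) * free (.Kinv i))
      (q ^ (-cartan i j) • free (.F j))
  | E_F (i j : Fin 3) : Rel q (free (.E i) * free (.F j) - free (.F j) * free (.E i))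
      (if i = j then (q - q⁻¹)⁻¹ • (free (.K i) - free (.Kinv i)) else 0)
  | serreE (i j : Fin 3) (h : i ≠ j) : Rel q
      (free (.E i) ^ 2 * free (.E j) - (q + q⁻¹) • (free (.E i) * free (.E j) * free (.E i))
        + free (.E j) * free (.E i) ^ 2) 0
  | serreF (i j : Fin 3) (h : i ≠ j) : Rel q
      (free (.F i) ^ 2 * free (.F j) - (q + q⁻¹) • (free (.F i) * free (.F j) * free (.F i))
        + free (.F j) * free (.F i) ^ 2) 0

/-- The quantized enveloping algebra `U_q(A₂⁽¹⁾)`. -/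
abbrev Alg (q : 𝕜) : Type _ := RingQuot (Rel q)

/-- The element `E_i` of `U_q(A₂⁽¹⁾)`. -/
def E (q : 𝕜) (i : Fin 3) : Alg q := RingQuot.mkAlgHom 𝕜 (Rel q) (free (.E i))

/-- The positive part of `U_q(A₂⁽¹⁾)`: the (unital) subalgebra generated by `E_1, E_2, E_3`. -/
def posPart (q : 𝕜) : Subalgebra 𝕜 (Alg q) := Algebra.adjoin 𝕜 (Set.range (E q))

/-- The quantum Serre relations of type `A₂⁽¹⁾`, on three free letters. -/
inductive SerreRel (q : 𝕜) : FreeAlgebra 𝕜 (Fin 3) → FreeAlgebra 𝕜 (Fin 3) → Prop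
  | serre (i j : Fin 3) (h : i ≠ j) : SerreRel q
      (FreeAlgebra.ι 𝕜 i ^ 2 * FreeAlgebra.ι 𝕜 j
        - (q + q⁻¹) • (FreeAlgebra.ι 𝕜 i * FreeAlgebra.ι 𝕜 j * FreeAlgebra.ι 𝕜 i)
        + FreeAlgebra.ι 𝕜 j * FreeAlgebra.ι 𝕜 i ^ 2) 0

/-- The algebra presented by three generators and the quantum Serre relations. -/
abbrev SerreAlg (q : 𝕜) : Type _ := RingQuot (SerreRel q)

/-- The generators of the algebra presented by the quantum Serre relations. -/
def serreGen (q : 𝕜) (i : Fin 3) : SerreAlg q :=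
  RingQuot.mkAlgHom 𝕜 (SerreRel q) (FreeAlgebra.ι 𝕜 i)

end Uq

end UqAffine

end

noncomputable section

namespace UqAffine

/-! For these parameters the six down-up relations are the quantum Serre relations rearranged, so
everything reduces to injectivity of the canonical map from the Serre algebra `S` to `U_q`. For
this, `U_q` is made to act on `S` as on a lowest weight Verma module: `E_i` by left multiplication,
`K_i` by rescaling generators, and `F_i` by killing `1` and obeying the recursion that the relation
between `E_j` and `F_i` forces (`fAct_serreGen_mul`). Composing `S → U_q → End S` gives the left
regular representation, which is faithful (`serreToAlg_injective`). The work lies in showing that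
`F_i` is well defined on `S` (`tripleStep_serre`) and that the `F_i` satisfy the Serre relations
(`fAct_serre`). -/

lemma cartan_self (i : Fin 3) : cartan i i = 2 := by fin_cases i <;> rfl

lemma cartan_of_ne {i j : Fin 3} (h : i ≠ j) : cartan i j = -1 := by
  fin_cases i <;> fin_cases j <;> first | rfl | exact absurd rfl h

/-! ### The Serre algebra and its torus action -/

section Serre

variable {𝕜 : Type*} [Field 𝕜] (q : 𝕜)

lemma serreGen_serre {i j : Fin 3} (h : i ≠ j) :
    serreGen q i ^ 2 * serreGen q j - (q + q⁻¹) • (serreGen q i * serreGen q j * serreGen q i)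
      + serreGen q j * serreGen q i ^ 2 = 0 := by
  have := RingQuot.mkAlgHom_rel 𝕜 (SerreRel.serre (q := q) i j h)
  simpa [serreGen] using this

/-- Right-associated form with a tail, usable as a rewrite rule that reduces operator identities to
comparisons of scalars. -/
lemma serreGen_serre_apply {i j : Fin 3} (h : i ≠ j) (x : SerreAlg q) :
    serreGen q i * (serreGen q i * (serreGen q j * x))
      = (q + q⁻¹) • (serreGen q i * (serreGen q j * (serreGen q i * x)))
      - serreGen q j * (serreGen q i * (serreGen q i * x)) := by
  have := congrArg (· * x) (serreGen_serre q h)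
  simp only [sub_mul, add_mul, pow_two, smul_mul_assoc, mul_assoc, zero_mul] at this
  linear_combination (norm := module) this

/-- The universal property of the algebra presented by the quantum Serre relations. -/
def serreLift {B : Type*} [Ring B] [Algebra 𝕜 B] (f : Fin 3 → B)
    (hf : ∀ i j, i ≠ j → f i ^ 2 * f j - (q + q⁻¹) • (f i * f j * f i) + f j * f i ^ 2 = 0) :
    SerreAlg q →ₐ[𝕜] B :=
  RingQuot.liftAlgHom 𝕜 ⟨FreeAlgebra.lift 𝕜 f, by
    rintro _ _ ⟨i, j, h⟩
    simpa using hf i j h⟩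

@[simp] lemma serreLift_serreGen {B : Type*} [Ring B] [Algebra 𝕜 B] (f : Fin 3 → B)
    (hf : ∀ i j, i ≠ j → f i ^ 2 * f j - (q + q⁻¹) • (f i * f j * f i) + f j * f i ^ 2 = 0)
    (i : Fin 3) : serreLift q f hf (serreGen q i) = f i := by
  simp [serreLift, serreGen]

variable {q} in
lemma serreAlg_hom_ext {B : Type*} [Semiring B] [Algebra 𝕜 B] {f g : SerreAlg q →ₐ[𝕜] B}
    (h : ∀ i, f (serreGen q i) = g (serreGen q i)) : f = g := by
  apply RingQuot.ringQuot_ext'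
  apply FreeAlgebra.hom_ext
  funext i
  exact h i

lemma adjoin_range_serreGen : Algebra.adjoin 𝕜 (Set.range (serreGen q)) = ⊤ := by
  have h : Set.range (serreGen q)
      = RingQuot.mkAlgHom 𝕜 (SerreRel q) '' Set.range (FreeAlgebra.ι 𝕜) := by
    rw [← Set.range_comp]; rfl
  rw [h, ← AlgHom.map_adjoin, FreeAlgebra.adjoin_range_ι, Algebra.map_top]
  exact (AlgHom.range_eq_top _).2 (RingQuot.mkAlgHom_surjective 𝕜 _)

variable {q} in
/-- A linear map out of the Serre algebra vanishes if it kills `1` and its kernel is stable under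
left multiplication by the generators. -/
lemma linearMap_eq_zero {M : Type*} [AddCommGroup M] [Module 𝕜 M] (D : SerreAlg q →ₗ[𝕜] M)
    (h1 : D 1 = 0) (hD : ∀ k x, D x = 0 → D (serreGen q k * x) = 0) : D = 0 := by
  have key : ∀ s ∈ Algebra.adjoin 𝕜 (Set.range (serreGen q)),
      ∀ x, D x = 0 → D (s * x) = 0 := by
    intro s hs
    induction hs using Algebra.adjoin_induction with
    | mem s hs => obtain ⟨k, rfl⟩ := hs; exact hD k
    | algebraMap r => intro x hx; rw [← Algebra.smul_def, map_smul, hx, smul_zero]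
    | add s t _ _ hs ht => intro x hx; rw [add_mul, map_add, hs x hx, ht x hx, add_zero]
    | mul s t _ _ hs ht => intro x hx; rw [mul_assoc]; exact hs _ (ht x hx)
  ext s
  simpa using key s (by rw [adjoin_range_serreGen]; trivial) 1 h1

/-- The endomorphism of the Serre algebra rescaling the `j`-th generator by `c j`. -/
def rescale (c : Fin 3 → 𝕜) : SerreAlg q →ₐ[𝕜] SerreAlg q :=
  serreLift q (fun j => c j • serreGen q j) (fun i j h => by
    -- The Serre element has degree two in `i` and one in `j`, so rescaling multiplies it by `c i ^
    -- 2 * c j`.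
    have := congrArg ((c i ^ 2 * c j) • ·) (serreGen_serre q h)
    simp only [smul_zero] at this
    rw [← this]
    simp only [pow_two, smul_mul_assoc, mul_smul_comm, smul_add, smul_sub]
    module)

@[simp] lemma rescale_serreGen (c : Fin 3 → 𝕜) (j : Fin 3) :
    rescale q c (serreGen q j) = c j • serreGen q j := by simp [rescale]

lemma rescale_rescale (c d : Fin 3 → 𝕜) (x : SerreAlg q) :
    rescale q c (rescale q d x) = rescale q (c * d) x := by
  have : (rescale q c).comp (rescale q d) = rescale q (c * d) :=
    serreAlg_hom_ext fun i => by simp [smul_smul, mul_comm]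
  exact DFunLike.congr_fun this x

lemma rescale_one (x : SerreAlg q) : rescale q 1 x = x := by
  have : rescale q 1 = AlgHom.id 𝕜 _ := serreAlg_hom_ext fun i => by simp
  exact DFunLike.congr_fun this x

/-- The action of `K_i` on the Serre algebra. -/
def kAct (i : Fin 3) : SerreAlg q →ₐ[𝕜] SerreAlg q := rescale q fun j => q ^ cartan i j

/-- The action of `K_i⁻¹` on the Serre algebra. -/
def kInvAct (i : Fin 3) : SerreAlg q →ₐ[𝕜] SerreAlg q := rescale q fun j => q ^ (-cartan i j)

@[simp] lemma kAct_serreGen_mul (i j : Fin 3) (x : SerreAlg q) :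
    kAct q i (serreGen q j * x) = q ^ cartan i j • (serreGen q j * kAct q i x) := by
  simp [kAct]

@[simp] lemma kInvAct_serreGen_mul (i j : Fin 3) (x : SerreAlg q) :
    kInvAct q i (serreGen q j * x) = q ^ (-cartan i j) • (serreGen q j * kInvAct q i x) := by
  simp [kInvAct]

lemma kAct_comm (i j : Fin 3) (x : SerreAlg q) :
    kAct q i (kAct q j x) = kAct q j (kAct q i x) := by
  simp only [kAct, rescale_rescale, mul_comm]

lemma kAct_kInvAct_comm (i j : Fin 3) (x : SerreAlg q) :
    kAct q i (kInvAct q j x) = kInvAct q j (kAct q i x) := by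
  simp only [kAct, kInvAct, rescale_rescale, mul_comm]

variable {q} (hq : q ≠ 0)
include hq

lemma kAct_kInvAct (i : Fin 3) (x : SerreAlg q) : kAct q i (kInvAct q i x) = x := by
  have : ((fun j => q ^ cartan i j) * fun j => q ^ (-cartan i j)) = 1 := by
    funext j; simp [zpow_ne_zero, hq]
  rw [kAct, kInvAct, rescale_rescale, this, rescale_one]

end Serre

/-! ### The Verma module and injectivity into `U_q` -/

section Verma

variable {𝕜 : Type*} [Field 𝕜] (q : 𝕜)

/-- Left multiplication by `e_j`, acting on triples `(K_i x, K_i⁻¹ x, F_i x)`. -/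
def tripleStep (i j : Fin 3) :
    Module.End 𝕜 (SerreAlg q × SerreAlg q × SerreAlg q) where
  toFun p := (q ^ cartan i j • (serreGen q j * p.1), q ^ (-cartan i j) • (serreGen q j * p.2.1),
    serreGen q j * p.2.2 - (if i = j then (q - q⁻¹)⁻¹ else 0) • (p.1 - p.2.1))
  map_add' p p' := by
    ext
    · simp only [Prod.fst_add, mul_add, smul_add]
    · simp only [Prod.fst_add, Prod.snd_add, mul_add, smul_add]
    · simp only [Prod.fst_add, Prod.snd_add, mul_add]
      module
  map_smul' c p := by
    ext <;> simp only [Prod.smul_fst, Prod.smul_snd, mul_smul_comm, RingHom.id_apply] <;> module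

lemma tripleStep_apply (i j : Fin 3) (p : SerreAlg q × SerreAlg q × SerreAlg q) :
    tripleStep q i j p =
      (q ^ cartan i j • (serreGen q j * p.1), q ^ (-cartan i j) • (serreGen q j * p.2.1),
        serreGen q j * p.2.2 - (if i = j then (q - q⁻¹)⁻¹ else 0) • (p.1 - p.2.1)) := rfl

variable {q} (hq : q ≠ 0)

include hq in
-- The recursion for `F_i` also involves `K_i` and `K_i⁻¹`, but the triple of `e_j x` depends
-- linearly on that of `x` alone. Once these linear maps satisfy the Serre relations, the recursion
-- descends from words to `S`.
lemma tripleStep_serre (k i j : Fin 3) (h : i ≠ j) :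
    tripleStep q k i ^ 2 * tripleStep q k j
      - (q + q⁻¹) • (tripleStep q k i * tripleStep q k j * tripleStep q k i)
      + tripleStep q k j * tripleStep q k i ^ 2 = 0 := by
  refine LinearMap.ext fun p => ?_
  obtain ⟨u, v, w⟩ := p
  simp only [LinearMap.add_apply, LinearMap.sub_apply, LinearMap.smul_apply, pow_two,
    Module.End.mul_apply, tripleStep_apply, LinearMap.zero_apply]
  ext
  · simp only [Prod.fst_add, Prod.fst_sub, Prod.smul_fst, Prod.fst_zero, mul_smul_comm,
      serreGen_serre_apply q h]
    module
  · simp only [Prod.fst_add, Prod.fst_sub, Prod.smul_fst, Prod.fst_zero, mul_smul_comm,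
      Prod.snd_add, Prod.snd_sub, Prod.smul_snd, Prod.snd_zero, serreGen_serre_apply q h]
    module
  · simp only [Prod.snd_add, Prod.snd_sub, Prod.smul_snd, Prod.snd_zero, mul_smul_comm,
      mul_sub, serreGen_serre_apply q h]
    -- Correction terms arise only when `k` is `i` or `j`; there the powers of `q` from the Cartan
    -- entries `2` and `-1` cancel against `q + q⁻¹`.
    rcases eq_or_ne k i with rfl | hki
    · simp only [if_true, if_neg h, cartan_self, cartan_of_ne h, neg_neg,
        zpow_neg, zpow_one]
      match_scalars <;> field_simp <;> ring
    · rcases eq_or_ne k j with rfl | hkj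
      · simp only [if_true, if_neg hki, cartan_self, cartan_of_ne hki, neg_neg, zpow_neg, zpow_one]
        match_scalars <;> field_simp <;> ring
      · simp only [if_neg hki, if_neg hkj]
        module

/-- The action of left multiplication on triples `(K_i x, K_i⁻¹ x, F_i x)`. -/
def tripleHom (i : Fin 3) :
    SerreAlg q →ₐ[𝕜] Module.End 𝕜 (SerreAlg q × SerreAlg q × SerreAlg q) :=
  serreLift q (tripleStep q i) (tripleStep_serre hq i)

/-- The action of `F_i` on the Serre algebra. -/
def fAct (i : Fin 3) : SerreAlg q →ₗ[𝕜] SerreAlg q where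
  toFun x := (tripleHom hq i x (1, 1, 0)).2.2
  map_add' x y := by simp
  map_smul' c x := by simp

/-- The starting vector `(1, 1, 0)` is the triple of `1`, and `tripleStep` reproduces the recursions
of `K_i` and `K_i⁻¹` in its first two entries. -/
lemma tripleHom_apply (i : Fin 3) (x : SerreAlg q) :
    tripleHom hq i x (1, 1, 0) = (kAct q i x, kInvAct q i x, fAct hq i x) := by
  let G : SerreAlg q →ₗ[𝕜] SerreAlg q × SerreAlg q × SerreAlg q :=
    (LinearMap.applyₗ (1, 1, 0)).comp (tripleHom hq i).toLinearMap
      - (kAct q i).toLinearMap.prod ((kInvAct q i).toLinearMap.prod (fAct hq i))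
  have hG : ∀ x, G x
      = tripleHom hq i x (1, 1, 0) - (kAct q i x, kInvAct q i x, fAct hq i x) := fun x => rfl
  have : G = 0 := by
    apply linearMap_eq_zero
    · rw [hG]; simp [fAct]
    · intro k x hx
      rw [hG, sub_eq_zero] at hx ⊢
      have h3 : fAct hq i (serreGen q k * x)
        = (tripleHom hq i (serreGen q k * x) (1, 1, 0)).2.2 := rfl
      rw [h3, map_mul, Module.End.mul_apply, hx, tripleHom, serreLift_serreGen, tripleStep_apply]
      simp
  have := DFunLike.congr_fun this x
  rwa [hG, LinearMap.zero_apply, sub_eq_zero] at this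

lemma fAct_one (i : Fin 3) : fAct hq i 1 = 0 := by simp [fAct]

lemma fAct_serreGen_mul (i j : Fin 3) (x : SerreAlg q) :
    fAct hq i (serreGen q j * x) = serreGen q j * fAct hq i x
      - (if i = j then (q - q⁻¹)⁻¹ else 0) • (kAct q i x - kInvAct q i x) := by
  have h3 : fAct hq i (serreGen q j * x)
    = (tripleHom hq i (serreGen q j * x) (1, 1, 0)).2.2 := rfl
  rw [h3, map_mul, Module.End.mul_apply, tripleHom_apply, tripleHom, serreLift_serreGen,
    tripleStep_apply]

/-- Both sides kill `1` and obey the same recursion under left multiplication by a generator. -/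
lemma kAct_fAct (i j : Fin 3) (x : SerreAlg q) :
    kAct q i (fAct hq j x) = q ^ (-cartan i j) • fAct hq j (kAct q i x) := by
  let D : SerreAlg q →ₗ[𝕜] SerreAlg q := (kAct q i).toLinearMap ∘ₗ fAct hq j
    - q ^ (-cartan i j) • (fAct hq j ∘ₗ (kAct q i).toLinearMap)
  have hD : ∀ x, D x = kAct q i (fAct hq j x) - q ^ (-cartan i j) • fAct hq j (kAct q i x) :=
    fun x => rfl
  have : D = 0 := by
    apply linearMap_eq_zero
    · simp [hD, fAct_one]
    · intro k x hx
      rw [hD, sub_eq_zero] at hx ⊢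
      rw [fAct_serreGen_mul, kAct_serreGen_mul, map_smul, fAct_serreGen_mul, map_sub,
        kAct_serreGen_mul, hx, map_smul, map_sub, kAct_comm q i j, kAct_kInvAct_comm q i j]
      split_ifs with hjk
      · subst hjk
        have : q ^ cartan i j ≠ 0 := zpow_ne_zero _ hq
        rw [zpow_neg, mul_smul_comm]
        match_scalars <;> field_simp
      · rw [mul_smul_comm]
        module
  have := DFunLike.congr_fun this x
  rwa [hD, LinearMap.zero_apply, sub_eq_zero] at this

include hq in
lemma kInvAct_kAct (i : Fin 3) (x : SerreAlg q) : kInvAct q i (kAct q i x) = x := by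
  rw [← kAct_kInvAct_comm, kAct_kInvAct hq]

lemma kInvAct_fAct (i j : Fin 3) (x : SerreAlg q) :
    kInvAct q i (fAct hq j x) = q ^ cartan i j • fAct hq j (kInvAct q i x) := by
  have h := kAct_fAct hq i j (kInvAct q i x)
  rw [kAct_kInvAct hq] at h
  have h' := congrArg (kInvAct q i) h
  rw [kInvAct_kAct hq, map_smul] at h'
  rw [h', smul_smul, ← zpow_add₀ hq, add_neg_cancel, zpow_zero, one_smul]

/-- The Serre expression in the `F`s kills `1` and commutes with left multiplication by each
generator, hence vanishes on `S`. -/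
lemma fAct_serre {i j : Fin 3} (h : i ≠ j) :
    fAct hq i ^ 2 * fAct hq j - (q + q⁻¹) • (fAct hq i * fAct hq j * fAct hq i)
      + fAct hq j * fAct hq i ^ 2 = (0 : Module.End 𝕜 (SerreAlg q)) := by
  apply linearMap_eq_zero
  · simp [pow_two, fAct_one]
  · intro k x hx
    simp only [LinearMap.add_apply, LinearMap.sub_apply, LinearMap.smul_apply, pow_two,
      Module.End.mul_apply] at hx ⊢
    have hx' := congrArg (serreGen q k * ·) hx
    simp only [mul_add, mul_sub, mul_smul_comm, mul_zero] at hx'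
    -- Replacing `0` by `e_k` times the vanishing value at `x` turns the goal into this commutation.
    rw [← hx']
    simp only [fAct_serreGen_mul, map_sub, map_smul, kAct_fAct, kInvAct_fAct]
    rcases eq_or_ne i k with rfl | hik
    · simp only [if_true, if_neg h.symm, cartan_self, cartan_of_ne h, neg_neg, zpow_neg, zpow_one]
      match_scalars <;> field_simp <;> ring
    · rcases eq_or_ne j k with rfl | hjk
      · simp only [if_true, if_neg hik, cartan_self, cartan_of_ne h.symm, neg_neg, zpow_neg, zpow_one]
        match_scalars <;> field_simp <;> ring
      · simp only [if_neg hik, if_neg hjk]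
        module

/-- The action of the generators of `U_q(A₂⁽¹⁾)` on the Serre algebra, viewed as the lowest weight
Verma module of weight zero. -/
def vermaGen : Gen → Module.End 𝕜 (SerreAlg q)
  | .E i => LinearMap.mulLeft 𝕜 (serreGen q i)
  | .F i => fAct hq i
  | .K i => (kAct q i).toLinearMap
  | .Kinv i => (kInvAct q i).toLinearMap

/-- The lowest weight Verma module of weight zero, realised on the Serre algebra. -/
def verma : Alg q →ₐ[𝕜] Module.End 𝕜 (SerreAlg q) :=
  RingQuot.liftAlgHom 𝕜 ⟨FreeAlgebra.lift 𝕜 (vermaGen hq), by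
    intro a b hab
    induction hab with
    | K_mul_Kinv i =>
      refine LinearMap.ext fun x => ?_
      simp [free, vermaGen, kAct_kInvAct hq]
    | Kinv_mul_K i =>
      refine LinearMap.ext fun x => ?_
      simp [free, vermaGen, kInvAct_kAct hq]
    | K_comm i j =>
      refine LinearMap.ext fun x => ?_
      simp [free, vermaGen, kAct_comm q i j]
    | K_E i j =>
      refine LinearMap.ext fun x => ?_
      simp [free, vermaGen, kAct_kInvAct hq]
    | K_F i j =>
      refine LinearMap.ext fun x => ?_
      simp [free, vermaGen, kAct_fAct, kAct_kInvAct hq]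
    | E_F i j =>
      refine LinearMap.ext fun x => ?_
      rcases eq_or_ne i j with rfl | h
      · simp [free, vermaGen, fAct_serreGen_mul]
      · simp [free, vermaGen, fAct_serreGen_mul, h, h.symm]
    | serreE i j h =>
      refine LinearMap.ext fun x => ?_
      simp [free, vermaGen, pow_two, serreGen_serre_apply q h]
    | serreF i j h =>
      simpa [free, vermaGen] using fAct_serre hq h⟩

lemma verma_E (i : Fin 3) : verma hq (E q i) = LinearMap.mulLeft 𝕜 (serreGen q i) := by
  simp [verma, E, free, vermaGen]

variable (q) in
/-- The canonical map from the Serre algebra to `U_q(A₂⁽¹⁾)`. -/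
def serreToAlg : SerreAlg q →ₐ[𝕜] Alg q :=
  serreLift q (E q) fun i j h => by
    have := RingQuot.mkAlgHom_rel 𝕜 (Rel.serreE (q := q) i j h)
    simpa [E] using this

lemma serreToAlg_serreGen (i : Fin 3) : serreToAlg q (serreGen q i) = E q i := by
  simp [serreToAlg]

include hq in
lemma serreToAlg_injective : Function.Injective (serreToAlg q) := by
  have h : (verma hq).comp (serreToAlg q) = Algebra.lmul 𝕜 (SerreAlg q) :=
    serreAlg_hom_ext fun i => by
      rw [AlgHom.comp_apply, serreToAlg_serreGen, verma_E]; rfl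
  have hinj : Function.Injective ((verma hq).comp (serreToAlg q)) := by
    -- Left multiplication is faithful: evaluate at `1`.
    rw [h]; exact Algebra.lmul_injective
  exact Function.Injective.of_comp (f := verma hq) hinj

lemma serreToAlg_range : (serreToAlg q).range = posPart q := by
  rw [← Algebra.map_top, ← adjoin_range_serreGen, AlgHom.map_adjoin, ← Set.range_comp, posPart]
  congr 2
  funext i
  exact serreToAlg_serreGen i

end Verma

end UqAffine

/-! ### Identification of the down-up algebra with the Serre algebra -/

namespace Z3DownUp

variable {𝕜 : Type*} [Field 𝕜] (q : 𝕜)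

open UqAffine (SerreAlg serreGen serreGen_serre serreLift serreLift_serreGen serreAlg_hom_ext)

/-- The numbering of the generators `A, B, C`. -/
def Gen.index : Gen → Fin 3
  | .A => 0
  | .B => 1
  | .C => 2

/-- The down-up algebra maps to the Serre algebra. -/
def toSerre : Alg (q + q⁻¹) (-1) 0 →ₐ[𝕜] SerreAlg q :=
  RingQuot.liftAlgHom 𝕜 ⟨FreeAlgebra.lift 𝕜 fun x => serreGen q x.index, by
    intro a b hab
    cases hab <;>
    simp only [free, map_mul, map_pow, map_add, map_smul, FreeAlgebra.lift_ι_apply, Gen.index]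
    · linear_combination (norm := module) serreGen_serre q (show (0 : Fin 3) ≠ 1 by decide)
    · linear_combination (norm := module) serreGen_serre q (show (1 : Fin 3) ≠ 0 by decide)
    · linear_combination (norm := module) serreGen_serre q (show (1 : Fin 3) ≠ 2 by decide)
    · linear_combination (norm := module) serreGen_serre q (show (2 : Fin 3) ≠ 1 by decide)
    · linear_combination (norm := module) serreGen_serre q (show (2 : Fin 3) ≠ 0 by decide)
    · linear_combination (norm := module) serreGen_serre q (show (0 : Fin 3) ≠ 2 by decide)⟩

lemma toSerre_gen (x : Gen) : toSerre q (gen (q + q⁻¹) (-1) 0 x) = serreGen q x.index := by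
  simp [toSerre, gen, free]

/-- The generator of the down-up algebra with a given number. -/
def genOfIndex (i : Fin 3) : Alg (q + q⁻¹) (-1) 0 :=
  gen (q + q⁻¹) (-1) 0 (![Gen.A, Gen.B, Gen.C] i)

lemma genOfIndex_serre {i j : Fin 3} (h : i ≠ j) :
    genOfIndex q i ^ 2 * genOfIndex q j
      - (q + q⁻¹) • (genOfIndex q i * genOfIndex q j * genOfIndex q i)
      + genOfIndex q j * genOfIndex q i ^ 2 = 0 := by
  have h1 := RingQuot.mkAlgHom_rel 𝕜 (Rel.BAA (α := q + q⁻¹) (β := -1) (γ := 0))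
  have h2 := RingQuot.mkAlgHom_rel 𝕜 (Rel.BBA (α := q + q⁻¹) (β := -1) (γ := 0))
  have h3 := RingQuot.mkAlgHom_rel 𝕜 (Rel.CBB (α := q + q⁻¹) (β := -1) (γ := 0))
  have h4 := RingQuot.mkAlgHom_rel 𝕜 (Rel.CCB (α := q + q⁻¹) (β := -1) (γ := 0))
  have h5 := RingQuot.mkAlgHom_rel 𝕜 (Rel.ACC (α := q + q⁻¹) (β := -1) (γ := 0))
  have h6 := RingQuot.mkAlgHom_rel 𝕜 (Rel.AAC (α := q + q⁻¹) (β := -1) (γ := 0))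
  simp only [map_mul, map_pow, map_add, map_smul] at h1 h2 h3 h4 h5 h6
  fin_cases i <;> fin_cases j <;> first | exact absurd rfl h | skip
  all_goals simp only [genOfIndex, gen, Fin.zero_eta, Fin.mk_one, Fin.reduceFinMk, Matrix.cons_val]
  -- Each ordered pair of distinct letters matches exactly one of the six relations.
  · linear_combination (norm := module) h1
  · linear_combination (norm := module) h6
  · linear_combination (norm := module) h2
  · linear_combination (norm := module) h3
  · linear_combination (norm := module) h5
  · linear_combination (norm := module) h4

/-- The Serre algebra maps to the down-up algebra. -/
def ofSerre : SerreAlg q →ₐ[𝕜] Alg (q + q⁻¹) (-1) 0 :=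
  serreLift q (genOfIndex q) fun _ _ h => genOfIndex_serre q h

lemma ofSerre_toSerre (x : Alg (q + q⁻¹) (-1) 0) : ofSerre q (toSerre q x) = x := by
  have : (ofSerre q).comp (toSerre q) = AlgHom.id 𝕜 _ := by
    apply RingQuot.ringQuot_ext'
    apply FreeAlgebra.hom_ext
    funext x
    change ofSerre q (toSerre q (gen (q + q⁻¹) (-1) 0 x)) = gen (q + q⁻¹) (-1) 0 x
    rw [toSerre_gen, ofSerre, serreLift_serreGen]
    cases x <;> rfl
  exact DFunLike.congr_fun this x

lemma toSerre_surjective : Function.Surjective (toSerre q) := by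
  have : (toSerre q).comp (ofSerre q) = AlgHom.id 𝕜 _ := serreAlg_hom_ext fun i => by
    rw [AlgHom.comp_apply, ofSerre, serreLift_serreGen, genOfIndex, toSerre_gen]
    fin_cases i <;> rfl
  exact fun x => ⟨ofSerre q x, DFunLike.congr_fun this x⟩

end Z3DownUp

end

theorem mainTheorem9 {𝕜 : Type*} [Field 𝕜] [IsAlgClosed 𝕜] [CharZero 𝕜]
    (q : 𝕜) (hq0 : q ≠ 0) (hq2 : q ^ 2 ≠ 1) :
    (∃ φ : Z3DownUp.Alg (q + q⁻¹) (-1) 0 →ₐ[𝕜] UqAffine.Alg q,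
      φ (Z3DownUp.gen (q + q⁻¹) (-1) 0 .A) = UqAffine.E q 0 ∧
      φ (Z3DownUp.gen (q + q⁻¹) (-1) 0 .B) = UqAffine.E q 1 ∧
      φ (Z3DownUp.gen (q + q⁻¹) (-1) 0 .C) = UqAffine.E q 2 ∧
      Function.Injective φ ∧
      φ.range = UqAffine.posPart q) ∧
    (∃ ψ : UqAffine.SerreAlg q ≃ₐ[𝕜] UqAffine.posPart q,
      ∀ i : Fin 3, (ψ (UqAffine.serreGen q i) : UqAffine.Alg q) = UqAffine.E q i) := by
  have hgen (x : Z3DownUp.Gen) : (UqAffine.serreToAlg q).comp (Z3DownUp.toSerre q)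
      (Z3DownUp.gen (q + q⁻¹) (-1) 0 x) = UqAffine.E q x.index := by
    rw [AlgHom.comp_apply, Z3DownUp.toSerre_gen, UqAffine.serreToAlg_serreGen]
  have hinj := UqAffine.serreToAlg_injective hq0
  refine ⟨⟨(UqAffine.serreToAlg q).comp (Z3DownUp.toSerre q), hgen .A, hgen .B, hgen .C, ?_, ?_⟩,
    (AlgEquiv.ofInjective _ hinj).trans (Subalgebra.equivOfEq _ _ UqAffine.serreToAlg_range),
    fun i => UqAffine.serreToAlg_serreGen i⟩
  · exact hinj.comp (Function.LeftInverse.injective (Z3DownUp.ofSerre_toSerre q))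
  · rw [AlgHom.range_comp, (AlgHom.range_eq_top _).2 (Z3DownUp.toSerre_surjective q),
      Algebra.map_top, UqAffine.serreToAlg_range]
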